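/- Let $G$ be a connected finite simple graph of order $n\ge 3$ with minimum degree $\delta$, and let $0=\sigma_0\le\sigma_1\le\cdots\le\sigma_{n-1}$ be its Laplacian eigenvalues, i.e. the eigenvalues, listed in increasing order with multiplicity, of $L(G)=D(G)-A(G)$, where $D(G)$ is the diagonal matrix of vertex degrees and $A(G)$ is the adjacency matrix of $G$. If $$\sigma_1\ \ge\ \frac{\sigma_{n-1}-\delta}{\sigma_{n-1}}\,n ,$$ then $G$ is Hamiltonian, i.e. $G$ has a cycle passing through every vertex. -/

import Mathlib

/-- The Laplacian eigenvalues of a finite simple graph `G` on `n` vertices, i.e. the eigenvalues of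
`L(G) = D(G) - A(G)` over `ℝ`, repeated according to multiplicity and listed in increasing order
`σ 0 ≤ σ 1 ≤ ⋯ ≤ σ (n - 1)`.  (Mathlib's `eigenvalues₀` lists them in decreasing order, hence
`Fin.rev`.) -/
noncomputable def laplacianEigenvalue {V : Type*} [Fintype V] [DecidableEq V]
    (G : SimpleGraph V) [DecidableRel G.Adj] (i : Fin (Fintype.card V)) : ℝ :=
  (G.isHermitian_lapMatrix ℝ).eigenvalues₀ i.rev

/-- The Laplacian eigenvalues are listed in increasing order. -/
theorem laplacianEigenvalue_mono {V : Type*} [Fintype V] [DecidableEq V]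
    (G : SimpleGraph V) [DecidableRel G.Adj] : Monotone (laplacianEigenvalue G) :=
  fun _ _ hij => (G.isHermitian_lapMatrix ℝ).eigenvalues₀_antitone (Fin.rev_le_rev.mpr hij)

/-!
Let `α` be the independence number of `G`. For an independent set `I` of size `α`, the Rayleigh
quotient of the indicator vector of `I`, projected orthogonally to the constant vectors, is at most
the largest Laplacian eigenvalue `σ`; this is the ratio bound `α ≤ (σ - δ) / σ * n`. If removing
`S` separates `A` from `B`, the Rayleigh quotient of the vector that is `#B` on `A`, `-#A` on `B`
and `0` on `S` is at most `#S`; this is Fiedler's bound `σ₁ ≤ #S`. The hypothesis thus says that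
`α` is at most the size of every vertex cut, and the Chvátal–Erdős theorem applies: if a longest
cycle `C` missed a vertex, let `H` be a component of `G - C`. The neighbours of `H` on `C` form a
vertex cut, but their successors along `C`, together with any vertex of `H`, are independent, as
otherwise `C` could be lengthened through `H`. So this cut has fewer than `α` vertices.
-/

open Finset Matrix RealInnerProductSpace

section EigenvectorBasis

variable {ι E : Type*} [Fintype ι] [NormedAddCommGroup E] [InnerProductSpace ℝ E]
  {T : E →ₗ[ℝ] E} {b : OrthonormalBasis ι ℝ E} {μ : ι → ℝ}

lemma inner_eigenvector_map (hb : ∀ i, T (b i) = μ i • b i) (i : ι) (x : E) :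
    ⟪b i, T x⟫ = μ i * ⟪b i, x⟫ := by
  classical
  conv_lhs => rw [← b.sum_repr' x]
  simp [map_sum, inner_sum, hb, inner_smul_right, b.inner_eq_ite, mul_comm]

lemma inner_map_self_eq_sum (hb : ∀ i, T (b i) = μ i • b i) (x : E) :
    ⟪x, T x⟫ = ∑ i, μ i * ⟪b i, x⟫ ^ 2 := by
  rw [← b.sum_inner_mul_inner]
  refine Finset.sum_congr rfl fun i _ => ?_
  rw [inner_eigenvector_map hb, real_inner_comm]
  ring

lemma inner_map_self_le_of_forall_le (hb : ∀ i, T (b i) = μ i • b i) {c : ℝ}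
    (hc : ∀ i, μ i ≤ c) (x : E) : ⟪x, T x⟫ ≤ c * ‖x‖ ^ 2 := by
  rw [inner_map_self_eq_sum hb, ← b.sum_sq_inner_right, Finset.mul_sum]
  gcongr with i
  exact hc i

lemma le_inner_map_self_of_inner_eq_zero_or_le (hb : ∀ i, T (b i) = μ i • b i) {c : ℝ} {x : E}
    (hc : ∀ i, ⟪b i, x⟫ = 0 ∨ c ≤ μ i) : c * ‖x‖ ^ 2 ≤ ⟪x, T x⟫ := by
  rw [inner_map_self_eq_sum hb, ← b.sum_sq_inner_right, Finset.mul_sum]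
  refine Finset.sum_le_sum fun i _ => ?_
  rcases hc i with h | h
  · simp [h]
  · gcongr

lemma le_inner_map_self_of_inner_eigenvector_eq_zero (hb : ∀ i, T (b i) = μ i • b i) {c m : ℝ}
    {j : ι} (hc : ∀ i ≠ j, c ≤ μ i) {u x : E} (hu : u ≠ 0) (hTu : T u = m • u)
    (hm : m ≤ μ j) (hux : ⟪u, x⟫ = 0) : c * ‖x‖ ^ 2 ≤ ⟪x, T x⟫ := by
  refine le_inner_map_self_of_inner_eq_zero_or_le hb fun i => ?_
  rcases le_or_gt c (μ j) with hj | hj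
  · exact .inr <| (eq_or_ne i j).elim (fun h => h ▸ hj) (hc i)
  -- Every other eigenvalue now exceeds `m`, so `u` is a multiple of `b j`.
  rcases ne_or_eq i j with hij | rfl
  · exact .inr (hc i hij)
  have horth : ∀ k ≠ i, ⟪b k, u⟫ = 0 := fun k hk => by
    have hmul : μ k * ⟪b k, u⟫ = m * ⟪b k, u⟫ := by
      rw [← inner_eigenvector_map hb, hTu, inner_smul_right]
    have hne : μ k ≠ m := (hm.trans_lt (hj.trans_le (hc k hk))).ne'
    exact (mul_eq_mul_right_iff.1 hmul).resolve_left hne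
  have hu_eq : u = ⟪b i, u⟫ • b i := by
    conv_lhs => rw [← b.sum_repr' u]
    exact Finset.sum_eq_single i (fun k _ hk => by rw [horth k hk, zero_smul]) (by simp)
  rw [hu_eq, real_inner_smul_left] at hux
  exact .inl <| (mul_eq_zero.1 hux).resolve_left fun h => hu (by rw [hu_eq, h, zero_smul])

end EigenvectorBasis

lemma norm_toLp_sq {ι : Type*} [Fintype ι] (x : ι → ℝ) : ‖WithLp.toLp 2 x‖ ^ 2 = x ⬝ᵥ x := by
  rw [EuclideanSpace.real_norm_sq_eq]
  simp [dotProduct, pow_two]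

lemma indepNum_pos {V : Type*} [Finite V] (G : SimpleGraph V) [Nonempty V] : 0 < G.indepNum := by
  have h : G.IsIndepSet ({Classical.arbitrary V} : Finset V) := by simp
  exact Nat.lt_of_lt_of_le (by simp) h.card_le_indepNum

section Laplacian

variable {V : Type*} [Fintype V] [DecidableEq V] {G : SimpleGraph V} [DecidableRel G.Adj]

variable (G) in
/-- An orthonormal basis of eigenvectors of the Laplacian, the `k`-th vector belonging to the `k`-th
eigenvalue in increasing order. -/
noncomputable def laplacianEigenbasis :
    OrthonormalBasis (Fin (Fintype.card V)) ℝ (EuclideanSpace ℝ V) :=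
  (G.isHermitian_lapMatrix ℝ).eigenvectorBasis.reindex
    ((Fintype.equivOfCardEq (Fintype.card_fin _)).symm.trans Fin.revPerm)

lemma toEuclideanLin_laplacianEigenbasis (k : Fin (Fintype.card V)) :
    (G.lapMatrix ℝ).toEuclideanLin (laplacianEigenbasis G k) =
      laplacianEigenvalue G k • laplacianEigenbasis G k := by
  have h := (G.isHermitian_lapMatrix ℝ).mulVec_eigenvectorBasis
    (Fintype.equivOfCardEq (Fintype.card_fin _) k.rev)
  ext v
  simpa [laplacianEigenbasis, laplacianEigenvalue, IsHermitian.eigenvalues] using congrFun h v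

lemma laplacianEigenvalue_nonneg (k : Fin (Fintype.card V)) : 0 ≤ laplacianEigenvalue G k := by
  have h := (G.posSemidef_lapMatrix ℝ).eigenvalues_nonneg
    (Fintype.equivOfCardEq (Fintype.card_fin _) k.rev)
  simpa [laplacianEigenvalue, IsHermitian.eigenvalues] using h

lemma inner_toEuclideanLin_self (A : Matrix V V ℝ) (x : V → ℝ) :
    ⟪WithLp.toLp 2 x, A.toEuclideanLin (WithLp.toLp 2 x)⟫ = x ⬝ᵥ A *ᵥ x := by
  simp [EuclideanSpace.inner_eq_star_dotProduct, dotProduct_comm]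

lemma dotProduct_lapMatrix_mulVec_le_of_forall_laplacianEigenvalue_le {c : ℝ}
    (hc : ∀ k, laplacianEigenvalue G k ≤ c) (x : V → ℝ) :
    x ⬝ᵥ G.lapMatrix ℝ *ᵥ x ≤ c * (x ⬝ᵥ x) := by
  rw [← inner_toEuclideanLin_self, ← norm_toLp_sq]
  exact inner_map_self_le_of_forall_le toEuclideanLin_laplacianEigenbasis hc _

lemma laplacianEigenvalue_one_mul_dotProduct_le (hV : 1 < Fintype.card V) {x : V → ℝ}
    (hx : ∑ v, x v = 0) :
    laplacianEigenvalue G ⟨1, hV⟩ * (x ⬝ᵥ x) ≤ x ⬝ᵥ G.lapMatrix ℝ *ᵥ x := by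
  have : Nonempty V := Fintype.card_pos_iff.1 (by omega)
  rw [← inner_toEuclideanLin_self, ← norm_toLp_sq]
  refine le_inner_map_self_of_inner_eigenvector_eq_zero (u := WithLp.toLp 2 fun _ => 1) (m := 0)
    (j := ⟨0, by omega⟩) toEuclideanLin_laplacianEigenbasis (fun k hk => ?_) ?_ ?_
    (laplacianEigenvalue_nonneg _) ?_
  · exact laplacianEigenvalue_mono G <| Fin.le_def.2 <|
      Nat.one_le_iff_ne_zero.2 fun h => hk (Fin.ext h)
  · exact fun h => one_ne_zero (congrFun (congrArg WithLp.ofLp h) (Classical.arbitrary V))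
  · simp [toLpLin_apply, G.lapMatrix_mulVec_const_eq_zero]
  · simpa [PiLp.inner_apply] using hx

lemma lapMatrix_mulVec_eq_sum_neighborFinset (x : V → ℝ) (v : V) :
    (G.lapMatrix ℝ *ᵥ x) v = ∑ w ∈ G.neighborFinset v, (x v - x w) := by
  simp [SimpleGraph.lapMatrix_mulVec_apply]

lemma sum_lapMatrix_mulVec (x : V → ℝ) : ∑ v, (G.lapMatrix ℝ *ᵥ x) v = 0 := by
  rw [← one_dotProduct, dotProduct_mulVec, ← mulVec_transpose, (G.isSymm_lapMatrix (R := ℝ)).eq]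
  simp [Pi.one_def, G.lapMatrix_mulVec_const_eq_zero]

lemma dotProduct_lapMatrix_mulVec_le_card_mul {S : Finset V} {x : V → ℝ} (hS : ∀ v ∈ S, x v = 0)
    (hadj : ∀ v w, G.Adj v w → v ∉ S → w ∉ S → x v = x w) :
    x ⬝ᵥ G.lapMatrix ℝ *ᵥ x ≤ #S * (x ⬝ᵥ x) := by
  have hterm : ∀ v, ∀ w ∈ G.neighborFinset v,
      x v * (x v - x w) ≤ if w ∈ S then x v * x v else 0 := fun v w hvw => by
    rw [SimpleGraph.mem_neighborFinset] at hvw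
    by_cases hw : w ∈ S
    · simp [hw, hS w hw]
    by_cases hv : v ∈ S
    · simp [hw, hS v hv]
    · simp [hw, hadj v w hvw hv hw]
  simp only [dotProduct, Finset.mul_sum, lapMatrix_mulVec_eq_sum_neighborFinset]
  refine Finset.sum_le_sum fun v _ => ?_
  calc ∑ w ∈ G.neighborFinset v, x v * (x v - x w)
      ≤ ∑ w ∈ G.neighborFinset v, if w ∈ S then x v * x v else 0 := Finset.sum_le_sum (hterm v)
    _ ≤ ∑ w, if w ∈ S then x v * x v else 0 :=
        Finset.sum_le_univ_sum_of_nonneg fun w => by split_ifs; exacts [mul_self_nonneg _, le_rfl]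
    _ = #S * (x v * x v) := by simp

lemma dotProduct_lapMatrix_mulVec_le_mul_sub [Nonempty V] {c : ℝ}
    (hc : ∀ k, laplacianEigenvalue G k ≤ c) (x : V → ℝ) :
    x ⬝ᵥ G.lapMatrix ℝ *ᵥ x ≤ c * (x ⬝ᵥ x - (∑ v, x v) ^ 2 / Fintype.card V) := by
  let m : ℝ := (∑ v, x v) / Fintype.card V
  let y : V → ℝ := x - m • 1
  have hLy : G.lapMatrix ℝ *ᵥ y = G.lapMatrix ℝ *ᵥ x := by
    rw [mulVec_sub, mulVec_smul, Pi.one_def, G.lapMatrix_mulVec_const_eq_zero, smul_zero, sub_zero]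
  have hyLy : y ⬝ᵥ G.lapMatrix ℝ *ᵥ y = x ⬝ᵥ G.lapMatrix ℝ *ᵥ x := by
    rw [hLy, sub_dotProduct, smul_dotProduct, one_dotProduct, sum_lapMatrix_mulVec,
      smul_zero, sub_zero]
  have hyy : y ⬝ᵥ y = x ⬝ᵥ x - (∑ v, x v) ^ 2 / Fintype.card V := by
    have hcard : (Fintype.card V : ℝ) ≠ 0 := by simp
    have hsum : ∑ v, y v = 0 := by simp [y, m, mul_div_cancel₀, hcard]
    calc y ⬝ᵥ y = x ⬝ᵥ y := by
          rw [show y = x - m • 1 from rfl, sub_dotProduct, smul_dotProduct, one_dotProduct, hsum,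
            smul_zero, sub_zero]
      _ = x ⬝ᵥ x - (∑ v, x v) ^ 2 / Fintype.card V := by
          rw [show y = x - m • 1 from rfl, dotProduct_sub, dotProduct_smul, dotProduct_one,
            smul_eq_mul]
          ring
  rw [← hyLy, ← hyy]
  exact dotProduct_lapMatrix_mulVec_le_of_forall_laplacianEigenvalue_le hc y

lemma indicator_dotProduct_lapMatrix_mulVec {I : Finset V} (hI : G.IsIndepSet I) :
    (fun v => if v ∈ I then (1 : ℝ) else 0) ⬝ᵥ
      G.lapMatrix ℝ *ᵥ (fun v => if v ∈ I then (1 : ℝ) else 0) = ∑ v ∈ I, (G.degree v : ℝ) := by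
  simp only [dotProduct, ite_mul, one_mul, zero_mul, sum_ite_mem, univ_inter]
  refine Finset.sum_congr rfl fun v hv => ?_
  have hout : ∀ w ∈ G.neighborFinset v, w ∉ I := fun w hvw hw => by
    rw [SimpleGraph.mem_neighborFinset] at hvw
    exact hI hv hw hvw.ne hvw
  rw [lapMatrix_mulVec_eq_sum_neighborFinset, Finset.sum_congr rfl fun w hw => by
    rw [if_pos hv, if_neg (hout w hw)]]
  simp

lemma card_mul_minDegree_le_of_isIndepSet [Nonempty V] {I : Finset V} (hI : G.IsIndepSet I)
    {c : ℝ} (hc : ∀ k, laplacianEigenvalue G k ≤ c) :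
    (#I : ℝ) * G.minDegree ≤ c * (#I - (#I : ℝ) ^ 2 / Fintype.card V) :=
  calc (#I : ℝ) * G.minDegree = ∑ _v ∈ I, (G.minDegree : ℝ) := by simp
    _ ≤ ∑ v ∈ I, (G.degree v : ℝ) := by
        gcongr
        exact G.minDegree_le_degree _
    _ ≤ c * (#I - (#I : ℝ) ^ 2 / Fintype.card V) := by
        rw [← indicator_dotProduct_lapMatrix_mulVec hI]
        simpa [dotProduct] using dotProduct_lapMatrix_mulVec_le_mul_sub hc
          fun v => if v ∈ I then (1 : ℝ) else 0

theorem indepNum_le_sub_minDegree_div_mul_card (hδ : 0 < G.minDegree) {c : ℝ}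
    (hc : ∀ k, laplacianEigenvalue G k ≤ c) :
    (G.indepNum : ℝ) ≤ (c - G.minDegree) / c * Fintype.card V := by
  have : Nonempty V := not_isEmpty_iff.1 fun _ => hδ.ne' (by simp)
  obtain ⟨I, hI⟩ := G.exists_isNIndepSet_indepNum
  have hbound := card_mul_minDegree_le_of_isIndepSet hI.isIndepSet hc
  have hle : (#I : ℝ) ≤ Fintype.card V := by exact_mod_cast card_le_univ I
  rw [hI.card_eq] at hbound hle
  have hα : (0 : ℝ) < G.indepNum := by exact_mod_cast indepNum_pos G
  have hn : (0 : ℝ) < Fintype.card V := hα.trans_le hle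
  have hδ' : (0 : ℝ) < G.minDegree := by exact_mod_cast hδ
  have hratio : (G.minDegree : ℝ) ≤ c * (1 - G.indepNum / Fintype.card V) := by
    refine le_of_mul_le_mul_left (hbound.trans_eq ?_) hα
    ring
  have hc0 : 0 < c :=
    pos_of_mul_pos_left (hδ'.trans_le hratio) (sub_nonneg.2 ((div_le_one hn).2 hle))
  calc (G.indepNum : ℝ) = (c - c * (1 - G.indepNum / Fintype.card V)) / c * Fintype.card V := by
        field_simp
        ring
    _ ≤ (c - G.minDegree) / c * Fintype.card V := by gcongr

end Laplacian

section Separation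

variable {V : Type*} [Fintype V] [DecidableEq V] {G : SimpleGraph V} [DecidableRel G.Adj]

variable (G) in
/-- The outer vertex boundary of `H`: the vertices outside `H` that have a neighbour in `H`. It is
the smallest set whose removal separates `H` from the remaining vertices. -/
def outerBoundary (H : Finset V) : Finset V :=
  {x | x ∉ H ∧ ∃ u ∈ H, G.Adj u x}

lemma mem_outerBoundary {H : Finset V} {x : V} :
    x ∈ outerBoundary G H ↔ x ∉ H ∧ ∃ u ∈ H, G.Adj u x := by
  simp [outerBoundary]

lemma disjoint_outerBoundary (H : Finset V) : Disjoint H (outerBoundary G H) :=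
  Finset.disjoint_left.2 fun _ hx hxN => (mem_outerBoundary.1 hxN).1 hx

lemma outerBoundary_singleton (v : V) : outerBoundary G {v} = G.neighborFinset v := by
  ext w
  simpa [mem_outerBoundary] using fun h : G.Adj v w => h.ne'

lemma exists_preconnected_outerBoundary_subset {S : Finset V} {h : V} (hS : h ∉ S) :
    ∃ H : Finset V, h ∈ H ∧ Disjoint H S ∧ (G.induce (H : Set V)).Preconnected ∧
      outerBoundary G H ⊆ S := by
  let P : Finset V → Prop := fun H =>
    h ∈ H ∧ Disjoint H S ∧ (G.induce (H : Set V)).Preconnected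
  have hsingle : ∀ x, (G.induce ({x} : Set V)).Preconnected :=
    fun _ => SimpleGraph.Preconnected.of_subsingleton
  have hP : P {h} :=
    ⟨mem_singleton_self h, disjoint_singleton_left.2 hS, (coe_singleton h).symm ▸ hsingle h⟩
  obtain ⟨H, ⟨hhH, hHS, hH⟩, hmax⟩ := (Set.toFinite {H | P H}).exists_maximal ⟨_, hP⟩
  refine ⟨H, hhH, hHS, hH, fun x hx => by_contra fun hxS => ?_⟩
  obtain ⟨hxH, u, hu, hux⟩ := mem_outerBoundary.1 hx
  refine hxH <| hmax (y := H ∪ {x}) ⟨mem_union_left _ hhH, ?_, ?_⟩ subset_union_left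
    (mem_union_right _ (mem_singleton_self x))
  · exact disjoint_union_left.2 ⟨hHS, disjoint_singleton_left.2 hxS⟩
  · rw [coe_union, coe_singleton]
    exact (SimpleGraph.connected_induce_union hH (hsingle x) hu
      (Set.mem_singleton x) hux).preconnected

lemma not_preconnected_induce_compl_of_outerBoundary_subset {A S : Finset V} (hA : A.Nonempty)
    (hAS : Disjoint A S) (hne : A ∪ S ≠ univ) (hsub : outerBoundary G A ⊆ S) :
    ¬(G.induce (S : Set V)ᶜ).Preconnected := by
  intro hconn
  obtain ⟨a, ha⟩ := hA
  obtain ⟨b, hb⟩ : ∃ b, b ∉ A ∪ S := by simpa [Finset.eq_univ_iff_forall] using hne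
  rw [mem_union, not_or] at hb
  obtain ⟨p⟩ := hconn ⟨a, by simpa using Finset.disjoint_left.1 hAS ha⟩ ⟨b, by simpa using hb.2⟩
  obtain ⟨d, -, hd, hd'⟩ := p.exists_boundary_dart {v | v.1 ∈ A} ha hb.1
  exact d.snd.2 <| hsub <| mem_outerBoundary.2 ⟨hd', _, hd, d.adj⟩

lemma exists_outerBoundary_subset_of_not_preconnected {S : Finset V}
    (hS : ¬(G.induce (S : Set V)ᶜ).Preconnected) :
    ∃ A : Finset V, A.Nonempty ∧ Disjoint A S ∧ A ∪ S ≠ univ ∧ outerBoundary G A ⊆ S := by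
  simp only [SimpleGraph.Preconnected, not_forall] at hS
  obtain ⟨⟨a, ha⟩, ⟨b, hb⟩, hab⟩ := hS
  obtain ⟨A, haA, hAS, hA, hsub⟩ :=
    exists_preconnected_outerBoundary_subset (G := G) (S := S) (h := a) (by simpa using ha)
  refine ⟨A, ⟨a, haA⟩, hAS, fun huniv => hab ?_, hsub⟩
  have hbA : b ∈ A := (mem_union.1 (huniv ▸ mem_univ b)).resolve_right (by simpa using hb)
  have hle : (A : Set V) ≤ (S : Set V)ᶜ := fun v hv => Finset.disjoint_left.1 hAS hv
  exact (hA ⟨a, haA⟩ ⟨b, hbA⟩).map (G.induceHomOfLE hle).toHom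

theorem laplacianEigenvalue_one_le_card_of_not_preconnected (hV : 1 < Fintype.card V)
    {S : Finset V} (hS : ¬(G.induce (S : Set V)ᶜ).Preconnected) :
    laplacianEigenvalue G ⟨1, hV⟩ ≤ #S := by
  obtain ⟨A, ⟨a, ha⟩, hAS, hne, hsub⟩ := exists_outerBoundary_subset_of_not_preconnected hS
  let B : Finset V := (A ∪ S)ᶜ
  have hB : 0 < (#B : ℝ) := by
    rwa [Nat.cast_pos, card_pos, nonempty_iff_ne_empty, Ne, compl_eq_empty_iff]
  have hAB : ∀ v ∈ A, v ∉ B := fun v hv => by simp [B, hv]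
  have hBS : ∀ v, v ∉ S → (v ∈ B ↔ v ∉ A) := fun v hv => by simp [B, hv]
  let x : V → ℝ := fun v => (if v ∈ A then (#B : ℝ) else 0) - if v ∈ B then (#A : ℝ) else 0
  have hsum : ∑ v, x v = 0 := by simp [x, mul_comm]
  have hpos : 0 < x ⬝ᵥ x := by
    refine Finset.sum_pos' (fun v _ => mul_self_nonneg _) ⟨a, mem_univ a, ?_⟩
    simpa [x, ha, hAB a ha] using hB.ne'
  have hxS : ∀ v ∈ S, x v = 0 := fun v hv => by
    simp [x, B, hv, Finset.disjoint_right.1 hAS hv]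
  have hadj : ∀ v w, G.Adj v w → v ∉ S → w ∉ S → x v = x w := fun v w hvw hv hw => by
    have hstep : ∀ {p q}, G.Adj p q → q ∉ S → p ∈ A → q ∈ A := fun hpq hq hp =>
      by_contra fun hqA => hq (hsub (mem_outerBoundary.2 ⟨hqA, _, hp, hpq⟩))
    have hiff : v ∈ A ↔ w ∈ A := ⟨hstep hvw hw, hstep hvw.symm hv⟩
    simp only [x, hBS v hv, hBS w hw, hiff]
  exact le_of_mul_le_mul_right ((laplacianEigenvalue_one_mul_dotProduct_le hV hsum).trans
    (dotProduct_lapMatrix_mulVec_le_card_mul hxS hadj)) hpos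

end Separation

section LongestCycle

variable {V : Type*} {G : SimpleGraph V} {a u v x y z : V}

lemma support_append_cons (p : G.Walk u v) (h : G.Adj v x) (q : G.Walk x y) :
    (p.append (.cons h q)).support = p.support ++ q.support := by
  simp [SimpleGraph.Walk.support_append]

lemma isCycle_cons_of_isPath {p : G.Walk u v} (hp : p.IsPath) (h : G.Adj v u)
    (hlen : 2 ≤ p.length) : (SimpleGraph.Walk.cons h p).IsCycle := by
  rw [SimpleGraph.Walk.isCycle_iff_isPath_tail_and_le_length]
  simpa [hp] using hlen

lemma exists_isPath_support_subset_of_preconnected_induce {H : Set V}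
    (hH : (G.induce H).Preconnected) (hu : u ∈ H) (hv : v ∈ H) :
    ∃ p : G.Walk u v, p.IsPath ∧ ∀ w ∈ p.support, w ∈ H := by
  obtain ⟨p, hp⟩ := hH.exists_isPath ⟨u, hu⟩ ⟨v, hv⟩
  let f : G.induce H →g G := (SimpleGraph.Embedding.induce H).toHom
  refine ⟨p.map f, hp.map Subtype.val_injective, fun w hw => ?_⟩
  obtain ⟨w, -, rfl⟩ := List.mem_map.1 (p.support_map f ▸ hw)
  exact w.2

lemma mem_tail_support_iff {c : G.Walk a a} (hc : ¬c.Nil) :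
    x ∈ c.support.tail ↔ x ∈ c.support := by
  rw [SimpleGraph.Walk.mem_support_iff]
  exact ⟨.inr, fun h => h.elim (fun hxa => hxa ▸ c.end_mem_tail_support hc) id⟩

/-- A cycle of maximum length among the cycles of `G`. -/
structure IsLongestCycle (c : G.Walk a a) : Prop where
  isCycle : c.IsCycle
  length_le : ∀ {b : V} {d : G.Walk b b}, d.IsCycle → d.length ≤ c.length

lemma exists_isLongestCycle [Finite V] {c : G.Walk a a} (hc : c.IsCycle) :
    ∃ (b : V) (d : G.Walk b b), IsLongestCycle d := by
  have := Fintype.ofFinite V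
  let P : ℕ → Prop := fun m => ∃ (b : V) (d : G.Walk b b), d.IsCycle ∧ d.length = m
  have hfin : {m | P m}.Finite := by
    refine (Set.finite_Iic (Fintype.card V)).subset ?_
    rintro _ ⟨b, d, hd, rfl⟩
    simpa using hd.support_nodup.length_le_card
  obtain ⟨_, ⟨b, d, hd, rfl⟩, hmax⟩ := hfin.exists_maximal ⟨_, a, c, hc, rfl⟩
  exact ⟨b, d, hd, fun {b' d'} hd' => (le_total _ _).elim id (hmax ⟨b', d', hd', rfl⟩)⟩

lemma IsLongestCycle.not_adj_of_support_perm {c : G.Walk a a} (hc : IsLongestCycle c)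
    {p : G.Walk u v} (hp : p.IsPath) (hpc : ∀ y ∈ p.support, y ∉ c.support) {w : G.Walk x y}
    (hw : w.support.Perm (c.support.tail ++ p.support)) : ¬G.Adj y x := by
  intro hadj
  have hpath : w.IsPath := .mk' <| hw.nodup_iff.2 <|
    hc.isCycle.support_nodup.append hp.support_nodup fun b hb hbp =>
      hpc b hbp (List.mem_of_mem_tail hb)
  have hlen : w.length = c.length + p.length := by
    have := hw.length_eq
    simp only [List.length_append, List.length_tail, SimpleGraph.Walk.length_support] at this
    omega
  have hthree := hc.isCycle.three_le_length
  have hle := hc.length_le (isCycle_cons_of_isPath hpath hadj (by omega))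
  rw [SimpleGraph.Walk.length_cons] at hle
  omega

variable [DecidableEq V]

/-- The permutation that sends every vertex of the cycle `c` to the next vertex along `c` and fixes
all other vertices. The base point of `c` is listed twice in its support, hence the `tail`. -/
def cycleSucc (c : G.Walk a a) : Equiv.Perm V :=
  c.support.tail.formPerm

variable {c : G.Walk a a}

lemma cycleSucc_mem_support (hc : c.IsCycle) (hx : x ∈ c.support) :
    cycleSucc c x ∈ c.support := by
  rw [← mem_tail_support_iff hc.not_nil] at hx ⊢
  exact List.formPerm_apply_mem_of_mem hx

lemma formPerm_support_apply_end (p : G.Walk u v) : p.support.formPerm v = u := by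
  have h := List.formPerm_apply_getLast u p.support.tail
  simpa using h

lemma cycleSucc_eq_of_support_isRotated (hc : c.IsCycle) {p : G.Walk u v}
    (hp : p.support ~r c.support.tail) : cycleSucc c v = u := by
  rw [cycleSucc, ← List.formPerm_eq_of_isRotated (hp.nodup_iff.2 hc.support_nodup) hp,
    formPerm_support_apply_end]

lemma exists_walk_cycleSucc (hc : c.IsCycle) (hx : x ∈ c.support) :
    ∃ p : G.Walk (cycleSucc c x) x, G.Adj x (cycleSucc c x) ∧ p.support ~r c.support.tail := by
  obtain ⟨y, hxy, p, hp⟩ := SimpleGraph.Walk.not_nil_iff.1 (hc.rotate hx).not_nil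
  have hrot : p.support ~r c.support.tail := by simpa [hp] using c.support_rotate x hx
  obtain rfl := cycleSucc_eq_of_support_isRotated hc hrot
  exact ⟨p, hxy, hrot⟩

lemma exists_walk_cycleSucc_walk_cycleSucc (hc : c.IsCycle) (hx : x ∈ c.support)
    (hz : z ∈ c.support) (hzx : z ≠ x) :
    ∃ (p : G.Walk (cycleSucc c x) z) (q : G.Walk (cycleSucc c z) x),
      p.support ++ q.support ~r c.support.tail := by
  obtain ⟨w, hadj, hw⟩ := exists_walk_cycleSucc hc hx
  have hzw : z ∈ w.support := hw.mem_iff.2 ((mem_tail_support_iff hc.not_nil).2 hz)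
  obtain ⟨y, hzy, q, hq⟩ := SimpleGraph.Walk.not_nil_iff.1
    (SimpleGraph.Walk.not_nil_of_ne (p := w.dropUntil z hzw) hzx)
  let p := w.takeUntil z hzw
  have hpq : p.support ++ q.support ~r c.support.tail := by
    rwa [← support_append_cons p hzy q, ← hq, w.take_spec hzw]
  have hqp : (q.append (.cons hadj p)).support ~r c.support.tail := by
    rw [support_append_cons]
    exact List.isRotated_append.trans hpq
  obtain rfl := cycleSucc_eq_of_support_isRotated hc hqp
  exact ⟨p, q, hpq⟩

lemma IsLongestCycle.not_adj_cycleSucc (hc : IsLongestCycle c) {p : G.Walk u v} (hp : p.IsPath)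
    (hpc : ∀ y ∈ p.support, y ∉ c.support) (hx : x ∈ c.support) (hxu : G.Adj x u) :
    ¬G.Adj v (cycleSucc c x) := by
  obtain ⟨q, -, hq⟩ := exists_walk_cycleSucc hc.isCycle hx
  refine hc.not_adj_of_support_perm hp hpc (w := q.append (.cons hxu p)) ?_
  rw [support_append_cons]
  exact hq.perm.append_right _

lemma IsLongestCycle.not_adj_cycleSucc_cycleSucc (hc : IsLongestCycle c) {p : G.Walk u v}
    (hp : p.IsPath) (hpc : ∀ y ∈ p.support, y ∉ c.support) (hx : x ∈ c.support)
    (hz : z ∈ c.support) (hzx : z ≠ x) (hzu : G.Adj z u) (hvx : G.Adj v x) :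
    ¬G.Adj (cycleSucc c z) (cycleSucc c x) := by
  -- The chord would close the walk that follows `c` from the successor of `x` to `z`, takes `p` to
  -- `x`, and follows `c` backwards from `x` to the successor of `z`.
  obtain ⟨q, r, hqr⟩ := exists_walk_cycleSucc_walk_cycleSucc hc.isCycle hx hz hzx
  refine hc.not_adj_of_support_perm hp hpc
    (w := q.append (.cons hzu (p.append (.cons hvx r.reverse)))) ?_
  rw [support_append_cons, support_append_cons, SimpleGraph.Walk.support_reverse]
  have hmove : (p.support ++ r.support.reverse).Perm (r.support ++ p.support) :=
    List.perm_append_comm.trans ((List.reverse_perm _).append_right _)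
  refine (hmove.append_left _).trans ?_
  rw [← List.append_assoc]
  exact hqr.perm.append_right _

end LongestCycle

section ChvatalErdos

variable {V : Type*} {G : SimpleGraph V}

lemma connected_of_indepNum_le_card_of_not_preconnected [Finite V] [Nonempty V]
    (hcut : ∀ S : Finset V, ¬(G.induce (S : Set V)ᶜ).Preconnected → G.indepNum ≤ #S) :
    G.Connected := by
  refine ⟨by_contra fun hG => (indepNum_pos G).not_ge (hcut ∅ ?_)⟩
  rwa [coe_empty, Set.compl_empty, G.induceUnivIso.preconnected_iff]

variable [Fintype V]

lemma exists_isCycle_of_two_le_degree [DecidableRel G.Adj] (hconn : G.Connected)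
    (hdeg : ∀ v, 2 ≤ G.degree v) : ∃ (a : V) (c : G.Walk a a), c.IsCycle := by
  by_contra! hac
  obtain ⟨v⟩ := hconn.nonempty
  obtain ⟨w, hw⟩ := (G.degree_pos_iff_exists_adj v).1 (Nat.zero_lt_two.trans_le (hdeg v))
  have : Nontrivial V := ⟨v, w, hw.ne⟩
  obtain ⟨u, hu⟩ := SimpleGraph.IsTree.exists_vert_degree_one_of_nontrivial ⟨hconn, hac⟩
  exact absurd (hdeg u) (by omega)

section OuterBoundary

variable [DecidableEq V] [DecidableRel G.Adj] {a : V} {c : G.Walk a a} {H : Finset V}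

lemma IsLongestCycle.not_adj_cycleSucc_of_mem_outerBoundary (hc : IsLongestCycle c)
    (hH : (G.induce (H : Set V)).Preconnected) (hHc : ∀ v ∈ H, v ∉ c.support)
    (hNc : ∀ v ∈ outerBoundary G H, v ∈ c.support) {v x : V} (hv : v ∈ H)
    (hx : x ∈ outerBoundary G H) : ¬G.Adj v (cycleSucc c x) := by
  obtain ⟨-, u, hu, hux⟩ := mem_outerBoundary.1 hx
  obtain ⟨p, hp, hpH⟩ := exists_isPath_support_subset_of_preconnected_induce hH hu hv
  exact hc.not_adj_cycleSucc hp (fun y hy => hHc y (hpH y hy)) (hNc x hx) hux.symm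

lemma IsLongestCycle.isIndepSet_image_cycleSucc_outerBoundary (hc : IsLongestCycle c)
    (hH : (G.induce (H : Set V)).Preconnected) (hHc : ∀ v ∈ H, v ∉ c.support)
    (hNc : ∀ v ∈ outerBoundary G H, v ∈ c.support) :
    G.IsIndepSet ((outerBoundary G H).image (cycleSucc c) : Finset V) := by
  rw [coe_image]
  rintro _ ⟨z, hz, rfl⟩ _ ⟨x, hx, rfl⟩ hne
  obtain ⟨-, u, hu, huz⟩ := mem_outerBoundary.1 hz
  obtain ⟨-, v, hv, hvx⟩ := mem_outerBoundary.1 hx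
  obtain ⟨p, hp, hpH⟩ := exists_isPath_support_subset_of_preconnected_induce hH hu hv
  exact hc.not_adj_cycleSucc_cycleSucc hp (fun y hy => hHc y (hpH y hy)) (hNc x hx) (hNc z hz)
    (ne_of_apply_ne _ hne) huz.symm hvx

lemma IsLongestCycle.card_outerBoundary_lt_indepNum (hc : IsLongestCycle c) (hne : H.Nonempty)
    (hH : (G.induce (H : Set V)).Preconnected) (hHc : ∀ v ∈ H, v ∉ c.support)
    (hNc : ∀ v ∈ outerBoundary G H, v ∈ c.support) : #(outerBoundary G H) < G.indepNum := by
  obtain ⟨h, hh⟩ := hne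
  have hnot : ∀ y ∈ (outerBoundary G H).image (cycleSucc c), y ∈ c.support ∧ ¬G.Adj h y := by
    simp only [Finset.forall_mem_image]
    exact fun x hx => ⟨cycleSucc_mem_support hc.isCycle (hNc x hx),
      hc.not_adj_cycleSucc_of_mem_outerBoundary hH hHc hNc hh hx⟩
  have hindep : G.IsIndepSet
      (insert h ((outerBoundary G H).image (cycleSucc c)) : Finset V) := by
    rw [SimpleGraph.IsIndepSet, coe_insert, Set.pairwise_insert]
    exact ⟨hc.isIndepSet_image_cycleSucc_outerBoundary hH hHc hNc,
      fun y hy _ => ⟨(hnot y hy).2, fun hyh => (hnot y hy).2 hyh.symm⟩⟩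
  rw [← Nat.add_one_le_iff, ← card_image_of_injective (outerBoundary G H) (cycleSucc c).injective,
    ← card_insert_of_notMem fun hmem => hHc h hh (hnot h hmem).1]
  exact hindep.card_le_indepNum

lemma IsLongestCycle.union_outerBoundary_ne_univ (hc : IsLongestCycle c)
    (hH : (G.induce (H : Set V)).Preconnected) (hHc : ∀ v ∈ H, v ∉ c.support)
    (hNc : ∀ v ∈ outerBoundary G H, v ∈ c.support) : H ∪ outerBoundary G H ≠ univ := by
  intro huniv
  have hmem : ∀ y ∈ c.support, y ∈ outerBoundary G H := fun y hy =>
    (mem_union.1 (huniv ▸ mem_univ y)).resolve_left fun hyH => hHc y hyH hy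
  have ha := hmem a c.start_mem_support
  have hsucc := hmem _ (cycleSucc_mem_support hc.isCycle c.start_mem_support)
  obtain ⟨-, u, hu, hadj⟩ := mem_outerBoundary.1 hsucc
  exact hc.not_adj_cycleSucc_of_mem_outerBoundary hH hHc hNc hu ha hadj

end OuterBoundary

lemma two_le_degree_of_indepNum_le_card_of_not_preconnected [DecidableRel G.Adj]
    (h3 : 3 ≤ Fintype.card V)
    (hcut : ∀ S : Finset V, ¬(G.induce (S : Set V)ᶜ).Preconnected → G.indepNum ≤ #S) (v : V) :
    2 ≤ G.degree v := by
  classical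
  by_contra! hdeg
  have hne : {v} ∪ outerBoundary G {v} ≠ univ := by
    intro huniv
    have hle := card_union_le {v} (outerBoundary G {v})
    rw [huniv, card_univ, card_singleton, outerBoundary_singleton,
      SimpleGraph.card_neighborFinset_eq_degree] at hle
    omega
  have hα := hcut _ <| not_preconnected_induce_compl_of_outerBoundary_subset
    (singleton_nonempty v) (disjoint_outerBoundary _) hne subset_rfl
  rw [outerBoundary_singleton, SimpleGraph.card_neighborFinset_eq_degree] at hα
  obtain ⟨w, hw⟩ : ∃ w, w ∉ {v} ∪ outerBoundary G {v} := by
    simpa [Finset.eq_univ_iff_forall] using hne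
  obtain ⟨hwv, hvw⟩ : w ≠ v ∧ ¬G.Adj v w := by simpa [outerBoundary_singleton] using hw
  have hpair : G.IsIndepSet ({v, w} : Finset V) := by
    simp [SimpleGraph.IsIndepSet, Set.pairwise_pair, hvw, G.adj_comm w v]
  have htwo := hpair.card_le_indepNum
  rw [card_pair hwv.symm] at htwo
  omega

theorem isHamiltonian_of_indepNum_le_card_of_not_preconnected [DecidableEq V]
    (h3 : 3 ≤ Fintype.card V)
    (hcut : ∀ S : Finset V, ¬(G.induce (S : Set V)ᶜ).Preconnected → G.indepNum ≤ #S) :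
    G.IsHamiltonian := by
  classical
  have : Nonempty V := Fintype.card_pos_iff.1 (by omega)
  obtain ⟨_, d, hd⟩ := exists_isCycle_of_two_le_degree
    (connected_of_indepNum_le_card_of_not_preconnected hcut)
    (two_le_degree_of_indepNum_le_card_of_not_preconnected h3 hcut)
  obtain ⟨a, c, hc⟩ := exists_isLongestCycle hd
  suffices hall : ∀ v, v ∈ c.support from fun _ => ⟨a, c,
    SimpleGraph.Walk.isHamiltonianCycle_iff_isCycle_and_support_count_tail_eq_one.2 ⟨hc.isCycle,
      fun v => List.count_eq_one_of_mem hc.isCycle.support_nodup <|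
        (mem_tail_support_iff hc.isCycle.not_nil).2 (hall v)⟩⟩
  by_contra! ⟨h, hh⟩
  obtain ⟨H, hhH, hHc, hH, hNc⟩ := exists_preconnected_outerBoundary_subset (G := G)
    (S := c.support.toFinset) (h := h) (by simpa using hh)
  have hHc' : ∀ v ∈ H, v ∉ c.support := fun v hv => by simpa using Finset.disjoint_left.1 hHc hv
  have hNc' : ∀ v ∈ outerBoundary G H, v ∈ c.support := fun v hv => by simpa using hNc hv
  have hsep := not_preconnected_induce_compl_of_outerBoundary_subset ⟨h, hhH⟩
    (disjoint_outerBoundary H) (hc.union_outerBoundary_ne_univ hH hHc' hNc') subset_rfl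
  exact (hcut _ hsep).not_gt (hc.card_outerBoundary_lt_indepNum ⟨h, hhH⟩ hH hHc' hNc')

end ChvatalErdos

theorem theorem3p4 {V : Type*} [Fintype V] [DecidableEq V]
    (G : SimpleGraph V) [DecidableRel G.Adj] (n : ℕ) (hn : Fintype.card V = n) (hn3 : 3 ≤ n)
    (hconn : G.Connected)
    (hσ : (laplacianEigenvalue G ⟨n - 1, by omega⟩ - (G.minDegree : ℝ))
        / laplacianEigenvalue G ⟨n - 1, by omega⟩ * (n : ℝ)
      ≤ laplacianEigenvalue G ⟨1, by omega⟩) :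
    G.IsHamiltonian := by
  subst hn
  have : Nontrivial V := Fintype.one_lt_card_iff_nontrivial.1 (by omega)
  have hδ : 0 < G.minDegree := hconn.preconnected.minDegree_pos_of_nontrivial
  have hmax : ∀ k, laplacianEigenvalue G k ≤
      laplacianEigenvalue G ⟨Fintype.card V - 1, by omega⟩ := fun k =>
    laplacianEigenvalue_mono G (Fin.le_def.2 (Nat.le_sub_one_of_lt k.2))
  refine isHamiltonian_of_indepNum_le_card_of_not_preconnected hn3 fun S hS => ?_
  have hcut : (G.indepNum : ℝ) ≤ #S :=
    calc (G.indepNum : ℝ) ≤ _ := indepNum_le_sub_minDegree_div_mul_card hδ hmax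
      _ ≤ laplacianEigenvalue G ⟨1, by omega⟩ := hσ
      _ ≤ #S := laplacianEigenvalue_one_le_card_of_not_preconnected (by omega) hS
  exact_mod_cast hcut
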